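/- For an integer $N\ge 1$ and real numbers $R,L>0$, $\gamma\ge 0$, put $\sigma=\gamma/L$ and suppose $\sigma\in[0,\sqrt N]$. Define the following quantities. * $u(\sigma)\ge 1$ is the unique solution $u\ge 1$ of $\sigma^2=u^2-1-2\log u$. * $\ell_N(\sigma)=\sqrt{1+N\nu}$, where $\nu\in[0,1]$ is the unique solution in $[0,1]$ of $\sum_{k=0}^{N-1}\frac{(N-k)\nu^2}{1+(N-(k+1))\nu}=\sigma^2$. * For $a\in\mathbb R^N$, $\tau,\nu_\star\in\mathbb R$ and $\nu_0,\dots,\nu_N\in\mathbb R$, let $\Lambda(\nu,\tau,a)$ be the symmetric $(2N+2)\times(2N+2)$ matrix, with rows and columns indexed by symbols $x,g_0,\dots,g_N,e_0,\dots,e_{N-1}$, whose entries are $\Lambda_{x,x}=\nu_\star$, $\Lambda_{x,g_i}=-\frac1{2(N+1)}$, $\Lambda_{g_i,g_i}=\nu_i$, $\Lambda_{g_i,g_j}=\frac{a_j}{2(N-j)}$ for $j<i$, $\Lambda_{g_i,e_j}=\frac{a_j}{2(N-j)}$ for $j<i$, $\Lambda_{e_j,e_j}=\tau$, and all other entries (up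 to symmetry) are zero. Then $$u_N^{\mathbb S}(\sigma)=\sqrt{N+1}\cdot\inf\Big\{\tau\sigma^2+\nu_\star+\sum_{k=0}^N\nu_k \;:\; \alpha\in\mathbb R_{\ge0}^N,\ \tau\ge0,\ \nu_\star,\nu_0,\dots,\nu_N\ge0,\ \Lambda(\nu,\tau,\alpha L/R)\succeq0\Big\}$$ (by rescaling $\alpha$, this value does not depend on $R,L$ for given $\sigma$). * $u_N^{\mathbb L}(\sigma)\ge 0$ is given by $$\big(u_N^{\mathbb L}(\sigma)\big)^2=\inf\Big\{\frac{\sigma^2+\sum_{k=0}^N y_k}{(N+1)y_0}\;:\; y_0>0,\ y_{k+1}\ge y_k+y_k^2\ \text{ for } k=0,\dots,N-1\Big\}.$$ Then, for every $N\ge1$ and $\sigma=\gamma/L\in[0,\sqrt N]$, $$\Big(1-\frac52\,\frac{\log(N+1)}{N}\Big)u(\sigma)\le \ell_N(\sigma)\le u_N^{\mathbb S}(\sigma)\le u_N^{\mathbb L}(\sigma)\le u(\sigma).$$ Consequently the relative gaps to the lower bound $\ell_N$ are $O(\log N/N)$, uniformly in $\sigma$: there is an absolute constant $C>0$ such that for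 all $N\ge2$, all $\sigma\in[0,\sqrt N]$ and each $v\in\{u_N^{\mathbb S}(\sigma),\,u_N^{\mathbb L}(\sigma),\,u(\sigma)\}$, $$\frac{v-\ell_N(\sigma)}{\ell_N(\sigma)}\le C\,\frac{\log N}{N}.$$ -/

import Mathlib

namespace SubgradSqueeze

noncomputable section

/-! ### The function `u` -/

/-- The set of solutions `u ≥ 1` of `σ² = u² - 1 - 2 log u`; it has exactly one element,
see `existsUnique_uSol`. -/
def uSol (σ : ℝ) : Set ℝ := {u | 1 ≤ u ∧ σ ^ 2 = u ^ 2 - 1 - 2 * Real.log u}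

/-- `u(σ)`: the unique `u ≥ 1` with `σ² = u² - 1 - 2 log u`. -/
def u (σ : ℝ) : ℝ := sInf (uSol σ)

theorem existsUnique_uSol (σ : ℝ) : ∃! x : ℝ, x ∈ uSol σ := by
  have hmono : StrictMonoOn (fun x : ℝ => x ^ 2 - 1 - 2 * Real.log x) (Set.Ici 1) := by
    intro x hx y hy hxy
    have hx1 : (1 : ℝ) ≤ x := hx
    have hx0 : 0 < x := by linarith
    have hy0 : 0 < y := by linarith
    have h1 : Real.log (y / x) ≤ y / x - 1 := Real.log_le_sub_one_of_pos (by positivity)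
    rw [Real.log_div hy0.ne' hx0.ne'] at h1
    have h2 : y / x - 1 ≤ y - x := by
      rw [div_sub_one hx0.ne']
      exact div_le_self (by linarith) hx1
    show x ^ 2 - 1 - 2 * Real.log x < y ^ 2 - 1 - 2 * Real.log y
    nlinarith
  have hcont : ContinuousOn (fun x : ℝ => x ^ 2 - 1 - 2 * Real.log x) (Set.Icc 1 (1 + |σ|)) := by
    refine ContinuousOn.sub (by fun_prop) (ContinuousOn.mul (by fun_prop) ?_)
    exact Real.continuousOn_log.mono fun x hx => by
      have := hx.1
      simp only [Set.mem_compl_iff, Set.mem_singleton_iff]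
      linarith
  have hs := abs_nonneg σ
  have hmem : σ ^ 2 ∈ Set.Icc ((1 : ℝ) ^ 2 - 1 - 2 * Real.log 1)
      ((1 + |σ|) ^ 2 - 1 - 2 * Real.log (1 + |σ|)) := by
    have h1 : Real.log (1 + |σ|) ≤ (1 + |σ|) - 1 := Real.log_le_sub_one_of_pos (by positivity)
    have h2 := sq_abs σ
    constructor
    · simp only [Real.log_one]
      nlinarith
    · nlinarith
  obtain ⟨x, hx, hxe⟩ := intermediate_value_Icc (by linarith) hcont hmem
  refine ⟨x, ⟨hx.1, hxe.symm⟩, ?_⟩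
  rintro y ⟨hy1, hye⟩
  exact hmono.injOn hy1 hx.1 (hye.symm.trans hxe.symm)

theorem u_mem (σ : ℝ) : u σ ∈ uSol σ := by
  obtain ⟨x, hx, hxu⟩ := existsUnique_uSol σ
  have hset : uSol σ = {x} := Set.eq_singleton_iff_unique_mem.2 ⟨hx, hxu⟩
  have : u σ = x := by rw [u, hset, csInf_singleton]
  rwa [this]

/-! ### The lower bound `ℓ_N` -/

/-- The set of solutions `ν ∈ [0, 1]` of
`∑_{k=0}^{N-1} (N - k) ν² / (1 + (N - (k + 1)) ν) = σ²`; for `1 ≤ N` and `0 ≤ σ ≤ √N` it has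
exactly one element, see `existsUnique_nuSol`. -/
def nuSol (N : ℕ) (σ : ℝ) : Set ℝ :=
  {ν | ν ∈ Set.Icc (0 : ℝ) 1 ∧
    ∑ k ∈ Finset.range N,
      (((N : ℝ) - k) * ν ^ 2) / (1 + ((N : ℝ) - (k + 1)) * ν) = σ ^ 2}

/-- The unique solution `ν ∈ [0, 1]`. -/
def nu (N : ℕ) (σ : ℝ) : ℝ := sInf (nuSol N σ)

/-- `ℓ_N(σ) = √(1 + N ν)`. -/
def ell (N : ℕ) (σ : ℝ) : ℝ := √(1 + N * nu N σ)

theorem existsUnique_nuSol (N : ℕ) (hN : 1 ≤ N) (σ : ℝ) (hσ : σ ∈ Set.Icc 0 √(N : ℝ)) :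
    ∃! ν : ℝ, ν ∈ nuSol N σ := by
  have hk : ∀ k ∈ Finset.range N, (0 : ℝ) ≤ (N : ℝ) - (k + 1) := by
    intro k hk
    have h : k + 1 ≤ N := Finset.mem_range.1 hk
    have h' : ((k + 1 : ℕ) : ℝ) ≤ N := by exact_mod_cast h
    push_cast at h'
    linarith
  have hmono : StrictMonoOn (fun ν : ℝ => ∑ k ∈ Finset.range N,
      (((N : ℝ) - k) * ν ^ 2) / (1 + ((N : ℝ) - (k + 1)) * ν)) (Set.Icc 0 1) := by
    intro x hx y hy hxy
    refine Finset.sum_lt_sum_of_nonempty ⟨0, Finset.mem_range.2 hN⟩ fun k hkm => ?_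
    have hm := hk k hkm
    have hx0 := hx.1
    have hy0 := hy.1
    rw [div_lt_div_iff₀ (by positivity) (by positivity)]
    have h1 : x ^ 2 * (1 + ((N : ℝ) - (k + 1)) * y) < y ^ 2 * (1 + ((N : ℝ) - (k + 1)) * x) := by
      have h2 : x ^ 2 < y ^ 2 := by nlinarith
      have h3 : 0 ≤ ((N : ℝ) - (k + 1)) * (x * y * (y - x)) :=
        mul_nonneg hm (mul_nonneg (mul_nonneg hx0 hy0) (by linarith))
      nlinarith
    have h4 : (0 : ℝ) < (N : ℝ) - k := by linarith
    have h5 := mul_lt_mul_of_pos_left h1 h4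
    linarith
  have hcont : ContinuousOn (fun ν : ℝ => ∑ k ∈ Finset.range N,
      (((N : ℝ) - k) * ν ^ 2) / (1 + ((N : ℝ) - (k + 1)) * ν)) (Set.Icc 0 1) := by
    refine continuousOn_finsetSum _ fun k hkm => ?_
    refine ContinuousOn.div (by fun_prop) (by fun_prop) fun x hx => ?_
    have := mul_nonneg (hk k hkm) hx.1
    linarith
  have hmem : σ ^ 2 ∈ Set.Icc
      (∑ k ∈ Finset.range N, (((N : ℝ) - k) * (0 : ℝ) ^ 2) / (1 + ((N : ℝ) - (k + 1)) * 0))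
      (∑ k ∈ Finset.range N, (((N : ℝ) - k) * (1 : ℝ) ^ 2) / (1 + ((N : ℝ) - (k + 1)) * 1)) := by
    have h1 : ∑ k ∈ Finset.range N,
        (((N : ℝ) - k) * (1 : ℝ) ^ 2) / (1 + ((N : ℝ) - (k + 1)) * 1) = (N : ℝ) := by
      rw [Finset.sum_congr rfl (g := fun _ => (1 : ℝ))]
      · simp
      · intro k hkm
        have := hk k hkm
        rw [div_eq_one_iff_eq (by linarith)]
        ring
    rw [h1]
    refine ⟨by simpa using sq_nonneg σ, ?_⟩
    have h2 := Real.sq_sqrt (Nat.cast_nonneg (α := ℝ) N)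
    have h3 := hσ.1
    have h4 := hσ.2
    nlinarith
  obtain ⟨x, hx, hxe⟩ := intermediate_value_Icc zero_le_one hcont hmem
  refine ⟨x, ⟨hx, hxe⟩, ?_⟩
  rintro y ⟨hy1, hye⟩
  exact hmono.injOn hy1 hx (hye.trans hxe.symm)

theorem nu_mem (N : ℕ) (hN : 1 ≤ N) (σ : ℝ) (hσ : σ ∈ Set.Icc 0 √(N : ℝ)) :
    nu N σ ∈ nuSol N σ := by
  obtain ⟨x, hx, hxu⟩ := existsUnique_nuSol N hN σ hσ
  have hset : nuSol N σ = {x} := Set.eq_singleton_iff_unique_mem.2 ⟨hx, hxu⟩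
  have : nu N σ = x := by rw [nu, hset, csInf_singleton]
  rwa [this]

/-! ### The semidefinite performance bound `u_N^𝕊` -/

/-- The coefficient `a_j / (2 (N - j))`. -/
def coef {N : ℕ} (a : Fin N → ℝ) (j : Fin N) : ℝ := a j / (2 * ((N : ℝ) - (j : ℕ)))

/-- The block of `Λ` indexed by the subgradients `g_0, …, g_N`: diagonal entries `ν_i`, and
entries `a_j / (2 (N - j))` with `j = min i k` at the off-diagonal positions `(i, k)`. -/
def gradBlock {N : ℕ} (ν : Fin (N + 1) → ℝ) (a : Fin N → ℝ) :
    Matrix (Fin (N + 1)) (Fin (N + 1)) ℝ :=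
  Matrix.of fun i k =>
    if h : i < k then coef a ⟨i, by omega⟩
    else if h : k < i then coef a ⟨k, by omega⟩
    else ν i

/-- The upper left block of `Λ`, indexed by `x_0 - x_⋆` and `g_0, …, g_N`. -/
def upperBlock {N : ℕ} (νstar : ℝ) (ν : Fin (N + 1) → ℝ) (a : Fin N → ℝ) :
    Matrix (Unit ⊕ Fin (N + 1)) (Unit ⊕ Fin (N + 1)) ℝ :=
  Matrix.fromBlocks
    (Matrix.of fun _ _ => νstar)
    (Matrix.of fun _ _ => -1 / (2 * ((N : ℝ) + 1)))
    (Matrix.of fun _ _ => -1 / (2 * ((N : ℝ) + 1)))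
    (gradBlock ν a)

/-- The upper right block of `Λ`, with columns indexed by the errors `e_0, …, e_{N-1}`: the entry
at `(g_i, e_j)` is `a_j / (2 (N - j))` if `j < i`, all other entries are zero. -/
def errBlock {N : ℕ} (a : Fin N → ℝ) : Matrix (Unit ⊕ Fin (N + 1)) (Fin N) ℝ :=
  Matrix.fromRows 0 (Matrix.of fun i j => if (j : ℕ) < (i : ℕ) then coef a j else 0)

/-- The matrix `Λ(ν, τ, a)` of size `2 N + 2`. -/
def Lam {N : ℕ} (νstar : ℝ) (ν : Fin (N + 1) → ℝ) (τ : ℝ) (a : Fin N → ℝ) :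
    Matrix ((Unit ⊕ Fin (N + 1)) ⊕ Fin N) ((Unit ⊕ Fin (N + 1)) ⊕ Fin N) ℝ :=
  Matrix.fromBlocks (upperBlock νstar ν a) (errBlock a) (errBlock a).transpose
    (τ • (1 : Matrix (Fin N) (Fin N) ℝ))

/-- The objective values attained on the feasible set of the semidefinite program. -/
def valuesS (N : ℕ) (R L σ : ℝ) : Set ℝ :=
  {v | ∃ (α : Fin N → ℝ) (τ νstar : ℝ) (ν : Fin (N + 1) → ℝ),
    (∀ k, 0 ≤ α k) ∧ 0 ≤ τ ∧ 0 ≤ νstar ∧ (∀ k, 0 ≤ ν k) ∧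
    (Lam νstar ν τ (fun k => α k * L / R)).PosSemidef ∧
    v = τ * σ ^ 2 + νstar + ∑ k, ν k}

/-- `u_N^𝕊(σ)`. -/
def uS (N : ℕ) (R L σ : ℝ) : ℝ := √((N : ℝ) + 1) * sInf (valuesS N R L σ)

/-! ### The second-order cone performance bound `u_N^𝕃` -/

/-- The objective values attained on the feasible set of the second-order cone program. The
objective is a quotient by `(N + 1) y_0`, so `y_0` has to be positive. -/
def valuesL (N : ℕ) (σ : ℝ) : Set ℝ :=
  {v | ∃ y : ℕ → ℝ, 0 < y 0 ∧ (∀ k < N, y k + y k ^ 2 ≤ y (k + 1)) ∧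
    v = (σ ^ 2 + ∑ k ∈ Finset.range (N + 1), y k) / (((N : ℝ) + 1) * y 0)}

/-- `u_N^𝕃(σ)`, the nonnegative number whose square is the value of the program. -/
def uL (N : ℕ) (σ : ℝ) : ℝ := √(sInf (valuesL N σ))

end

end SubgradSqueeze

namespace SubgradSqueeze

open Finset Matrix

/-! ### The gap between `ℓ_N` and `u` -/

/-! Each inequality in the chain comes from an explicit certificate. `ell_le_uS` is weak duality: a
Gram matrix of worst-case vectors annihilates every `a_j` term of `Λ`, leaving exactly a lower bound
on the objective. `uS_le_uL` maps a feasible sequence `y` to a feasible `Λ` whose quadratic form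
telescopes in tail sums of the `g_i`. `uL_le_u` inserts `y_k = 1 / (c - k)`, a discrete version of
the solution of `y' = y²`, and optimizes over `c`. The chain closes with `u_le_mul_ell`: with `w =
ℓ²`, the equation for `ν` is that of `u²`, namely `σ² = w - 1 - log w`, up to an error `(w - 1) log
(N + 1) / N`. -/

theorem log_one_add_mul_le_sum (ν : ℝ) (hν : 0 ≤ ν) (N : ℕ) :
    Real.log (1 + N * ν) ≤ ∑ m ∈ range N, ν / (1 + m * ν) := by
  induction N with
  | zero => simp
  | succ n ih =>
    rw [sum_range_succ]
    have h1 : (0 : ℝ) < 1 + n * ν := by positivity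
    have h2 : (0 : ℝ) < 1 + (n + 1 : ℕ) * ν := by positivity
    have h := Real.log_le_sub_one_of_pos (div_pos h2 h1)
    rw [Real.log_div h2.ne' h1.ne'] at h
    have h3 : (1 + (n + 1 : ℕ) * ν) / (1 + n * ν) - 1 = ν / (1 + n * ν) := by
      field_simp
      push_cast
      ring
    linarith

theorem sum_nu_eq (ν : ℝ) (hν : 0 ≤ ν) (N : ℕ) :
    ∑ k ∈ range N, (((N : ℝ) - k) * ν ^ 2) / (1 + ((N : ℝ) - (k + 1)) * ν)
      = N * ν - (1 - ν) * ∑ m ∈ range N, ν / (1 + m * ν) := by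
  -- With `m = N - 1 - k`, each term becomes `(m + 1) ν² / (1 + m ν) = ν - (1 - ν) ν / (1 + m ν)`.
  rw [← sum_range_reflect, mul_sum, ← nsmul_eq_mul, ← Finset.card_range N, ← sum_const,
    card_range, ← sum_sub_distrib]
  refine sum_congr rfl fun m hm => ?_
  have hm' : m + 1 ≤ N := mem_range.1 hm
  have hc : ((N - 1 - m : ℕ) : ℝ) = N - 1 - m := by
    rw [Nat.cast_sub (by omega), Nat.cast_sub (by omega), Nat.cast_one]
  have h1 : (0 : ℝ) < 1 + m * ν := by positivity
  have h2 : (1 + ((N : ℝ) - (N - 1 - m + 1)) * ν) = 1 + m * ν := by ring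
  rw [hc, h2]
  field_simp
  ring

theorem one_le_ell (N : ℕ) (hN : 1 ≤ N) (σ : ℝ) (hσ : σ ∈ Set.Icc 0 √(N : ℝ)) :
    1 ≤ ell N σ := by
  rw [ell, Real.one_le_sqrt]
  have := mul_nonneg (Nat.cast_nonneg (α := ℝ) N) (nu_mem N hN σ hσ).1.1
  linarith

theorem u_le_mul_ell (N : ℕ) (hN : 1 ≤ N) (σ : ℝ) (hσ : σ ∈ Set.Icc 0 √(N : ℝ)) :
    u σ ≤ (1 + Real.log ((N : ℝ) + 1) / N / 2) * ell N σ := by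
  obtain ⟨⟨hν0, hν1⟩, hsum⟩ := nu_mem N hN σ hσ
  obtain ⟨hu1, hu⟩ := u_mem σ
  have hell1 := one_le_ell N hN σ hσ
  have hell : ell N σ ^ 2 = 1 + N * nu N σ := Real.sq_sqrt (by positivity)
  set ν := nu N σ
  set v := u σ
  set l := ell N σ
  have hNpos : (0 : ℝ) < N := by exact_mod_cast hN
  set ε := Real.log ((N : ℝ) + 1) / N with hε
  have hε0 : 0 < ε := div_pos (Real.log_pos (by linarith)) hNpos
  set w := l ^ 2 with hw
  have hw1 : 1 ≤ w := by rw [hell]; nlinarith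
  have hσw : σ ^ 2 ≤ w - 1 - Real.log w + (w - 1) * ε := by
    rw [← hsum, sum_nu_eq ν hν0]
    have h1 := log_one_add_mul_le_sum ν hν0 N
    rw [← hell] at h1
    have h2 := mul_le_mul_of_nonneg_left h1 (sub_nonneg.2 hν1)
    have h3 : Real.log w ≤ Real.log ((N : ℝ) + 1) :=
      Real.log_le_log (by linarith) (by rw [hell]; nlinarith)
    have h4 := mul_le_mul_of_nonneg_left h3 hν0
    have h5 : (w - 1) * ε = ν * Real.log ((N : ℝ) + 1) := by
      rw [hell, hε]
      field_simp
      ring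
    nlinarith
  -- The function `x - 1 - log x` increases on `[1, ∞)` and equals `σ²` at `v²`; since `log (1 + ε)
  -- ≤ ε`, its value at `w (1 + ε)` already dominates the bound `hσw`.
  have hmain : v ^ 2 ≤ w * (1 + ε) := by
    by_contra! hlt
    have hw0 : 0 < w := by linarith
    have hV : 0 < w * (1 + ε) := by positivity
    have hV1 : 1 < w * (1 + ε) := by nlinarith
    have h1 := Real.log_le_sub_one_of_pos (show 0 < v ^ 2 / (w * (1 + ε)) by positivity)
    rw [Real.log_div (by positivity) hV.ne', Real.log_mul hw0.ne' (by positivity),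
      Real.log_pow] at h1
    have h2 := Real.log_le_sub_one_of_pos (show 0 < 1 + ε by positivity)
    have h3 : v ^ 2 / (w * (1 + ε)) - 1 < v ^ 2 - w * (1 + ε) := by
      rw [div_sub_one hV.ne']
      exact div_lt_self (by linarith) hV1
    push_cast at h1
    nlinarith
  refine le_of_sq_le_sq ?_ (by positivity)
  nlinarith [sq_nonneg ε]

/-! ### The second-order cone bound is at most `u` -/

theorem pos_of_add_sq_le {N : ℕ} {y : ℕ → ℝ} (hy0 : 0 < y 0)
    (hy : ∀ k < N, y k + y k ^ 2 ≤ y (k + 1)) : ∀ k ≤ N, 0 < y k := by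
  intro k hk
  induction k with
  | zero => exact hy0
  | succ k ih =>
    have := ih (by omega)
    nlinarith [hy k (by omega)]

theorem valuesL_nonneg {N : ℕ} {σ v : ℝ} (hv : v ∈ valuesL N σ) : 0 ≤ v := by
  obtain ⟨y, hy0, hy, rfl⟩ := hv
  have hpos := pos_of_add_sq_le hy0 hy
  have := sum_nonneg fun k (hk : k ∈ range (N + 1)) =>
    (hpos k (Nat.lt_succ_iff.1 (mem_range.1 hk))).le
  positivity

theorem sum_inv_sub_le_log (c : ℝ) (n : ℕ) (hc : (n : ℝ) < c) :
    ∑ k ∈ range n, 1 / (c - k) ≤ Real.log (c / (c - n)) := by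
  induction n with
  | zero =>
    have : c ≠ 0 := by
      rintro rfl
      simp at hc
    simp [this]
  | succ n ih =>
    push_cast at hc ⊢
    have h0 : (0 : ℝ) ≤ n := Nat.cast_nonneg n
    have h1 : 0 < c - n := by linarith
    have h2 : 0 < c - (n + 1) := by linarith
    have h3 : 0 < c := by linarith
    rw [sum_range_succ]
    have h4 := ih (by linarith)
    have h5 := Real.log_le_sub_one_of_pos (div_pos h2 h1)
    rw [Real.log_div h3.ne' h1.ne'] at h4
    rw [Real.log_div h2.ne' h1.ne'] at h5
    rw [Real.log_div h3.ne' h2.ne']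
    have h6 : (c - (n + 1)) / (c - n) - 1 = -(1 / (c - n)) := by
      field_simp
      ring
    linarith

/-- Value of the feasible sequence `y_k = 1 / (c - k)` with `c = (N + 1) s`; the slack `y_{k+1} -
y_k - y_k²` is `1 / ((c - k)² (c - k - 1))`. -/
theorem sInf_valuesL_le (N : ℕ) (σ s : ℝ) (hs : 1 < s) :
    sInf (valuesL N σ) ≤ s * (σ ^ 2 + Real.log (s / (s - 1))) := by
  have hN : (0 : ℝ) < (N : ℝ) + 1 := by positivity
  set c := ((N : ℝ) + 1) * s with hc
  have hcN : (N : ℝ) + 1 < c := by nlinarith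
  have hmem : (σ ^ 2 + ∑ k ∈ range (N + 1), 1 / (c - k)) / (((N : ℝ) + 1) * (1 / (c - (0 : ℕ))))
      ∈ valuesL N σ := by
    refine ⟨fun k => 1 / (c - k), ?_, fun k hk => ?_, rfl⟩
    · have : 0 < c - ((0 : ℕ) : ℝ) := by push_cast; linarith
      positivity
    · have hk' : (k : ℝ) + 1 ≤ N := by exact_mod_cast hk
      have h1 : 0 < c - k := by linarith
      have h2 : 0 < c - (k + 1) := by linarith
      have h3 : 1 / (c - (k + 1)) - (1 / (c - k) + (1 / (c - k)) ^ 2)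
          = 1 / ((c - k) ^ 2 * (c - (k + 1))) := by
        field_simp
        ring
      have h4 : 0 ≤ 1 / ((c - k) ^ 2 * (c - (k + 1))) := by positivity
      push_cast
      linarith
  refine (csInf_le ⟨0, fun v hv => valuesL_nonneg hv⟩ hmem).trans ?_
  have h := sum_inv_sub_le_log c (N + 1) (by push_cast; exact hcN)
  have h1 : c / (c - (N + 1 : ℕ)) = s / (s - 1) := by
    have : s - 1 ≠ 0 := by linarith
    have h2 : c - (N + 1 : ℕ) = ((N : ℝ) + 1) * (s - 1) := by
      rw [hc]
      push_cast
      ring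
    rw [h2, hc, mul_div_mul_left _ _ hN.ne']
  rw [h1] at h
  have h2 : ∀ A : ℝ, A / (((N : ℝ) + 1) * (1 / (c - (0 : ℕ)))) = s * A := by
    intro A
    have : s ≠ 0 := by linarith
    rw [hc]
    push_cast
    field_simp
    ring
  rw [h2]
  exact mul_le_mul_of_nonneg_left (by linarith) (by linarith)

theorem uL_le_u (N : ℕ) (σ : ℝ) : uL N σ ≤ u σ := by
  obtain ⟨hu1, hu⟩ := u_mem σ
  rw [uL, Real.sqrt_le_left (by linarith)]
  set v := u σ
  rcases hu1.eq_or_lt with h1 | h1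
  · rw [← h1] at hu ⊢
    have hσ : σ ^ 2 = 0 := by simpa using hu
    refine le_of_forall_pos_le_add fun ε hε => ?_
    -- For `u = 1` the optimal `s` is infinite, so it is only approached.
    have hs : 1 < 1 + 1 / ε := by
      have : 0 < 1 / ε := by positivity
      linarith
    refine (sInf_valuesL_le N σ _ hs).trans ?_
    rw [hσ]
    have h2 : (1 + 1 / ε) / (1 + 1 / ε - 1) = 1 + ε := by
      field_simp
      ring
    have h3 := Real.log_le_sub_one_of_pos (show 0 < 1 + ε by positivity)
    rw [h2]
    calc (1 + 1 / ε) * (0 + Real.log (1 + ε)) ≤ (1 + 1 / ε) * ε := by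
          gcongr
          linarith
      _ = 1 ^ 2 + ε := by
          field_simp
          ring
  · have h2 : 0 < v ^ 2 - 1 := by nlinarith
    -- This `s` gives `s / (s - 1) = v²`, so the bracket `σ² + 2 log v` collapses to `v² - 1` and
    -- the bound to `v²`.
    have hs : 1 < v ^ 2 / (v ^ 2 - 1) := by
      rw [one_lt_div h2]
      linarith
    refine (sInf_valuesL_le N σ _ hs).trans_eq ?_
    have h3 : v ^ 2 / (v ^ 2 - 1) / (v ^ 2 / (v ^ 2 - 1) - 1) = v ^ 2 := by
      field_simp
      ring
    rw [h3, Real.log_pow, hu]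
    push_cast
    field_simp
    ring

/-! ### The quadratic form of `Λ` -/

theorem sum_gradBlock {N : ℕ} (ν : Fin (N + 1) → ℝ) (a : Fin N → ℝ) (g : Fin (N + 1) → ℝ) :
    ∑ i, ∑ k, g i * (gradBlock ν a i k * g k) = ∑ i, ν i * g i ^ 2
      + 2 * ∑ j, coef a j * (g j.castSucc * ∑ i : Fin (N + 1), if (j : ℕ) < i then g i else 0) := by
  -- Strictly upper triangular part: `gradBlock` is its diagonal plus `U` plus the transpose of `U`.
  set U : Fin (N + 1) → Fin (N + 1) → ℝ :=
    fun i k => if h : i < k then coef a ⟨i, by omega⟩ else 0 with hU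
  have hsplit : ∀ i k, gradBlock ν a i k = (if i = k then ν i else 0) + U i k + U k i := by
    intro i k
    rcases lt_trichotomy i k with h | h | h
    · simp [gradBlock, hU, h, h.ne, h.not_gt]
    · simp [gradBlock, hU, h]
    · simp [gradBlock, hU, h, h.ne', h.not_gt]
  have hUsum : ∑ i, ∑ k, g i * (U i k * g k)
      = ∑ j, coef a j * (g j.castSucc * ∑ i : Fin (N + 1), if (j : ℕ) < i then g i else 0) := by
    rw [Fin.sum_univ_castSucc]
    have hlast : ∑ k, g (Fin.last N) * (U (Fin.last N) k * g k) = 0 :=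
      sum_eq_zero fun k _ => by simp [hU, (Fin.le_last k).not_gt]
    rw [hlast, add_zero]
    refine sum_congr rfl fun j _ => ?_
    rw [mul_sum, mul_sum]
    refine sum_congr rfl fun k _ => ?_
    simp only [hU, Fin.lt_def, Fin.val_castSucc]
    split_ifs
    · ring
    · ring
  have hUsum' : ∑ i, ∑ k, g i * (U k i * g k) = ∑ i, ∑ k, g i * (U i k * g k) := by
    rw [sum_comm]
    exact sum_congr rfl fun i _ => sum_congr rfl fun k _ => by ring
  have hdiag : ∑ i, ∑ k, g i * ((if i = k then ν i else 0) * g k) = ∑ i, ν i * g i ^ 2 := by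
    refine sum_congr rfl fun i _ => ?_
    simp only [ite_mul, zero_mul, mul_ite, mul_zero, sum_ite_eq, mem_univ, if_true]
    ring
  simp only [hsplit, add_mul, mul_add, sum_add_distrib]
  rw [hUsum', hUsum, hdiag]
  ring

/-- Grouping by `coef a j` shows that `g_j` and `e_j` enter these terms only through `g_j + e_j`,
paired with the tail sum of `g_i` over `i > j`; both certificates rest on this. -/
theorem Lam_quadForm {N : ℕ} (νstar : ℝ) (ν : Fin (N + 1) → ℝ) (τ : ℝ) (a : Fin N → ℝ)
    (x : ℝ) (g : Fin (N + 1) → ℝ) (e : Fin N → ℝ) :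
    (Sum.elim (Sum.elim (fun _ : Unit => x) g) e) ⬝ᵥ
        (Lam νstar ν τ a *ᵥ Sum.elim (Sum.elim (fun _ : Unit => x) g) e)
      = νstar * x ^ 2 - x * (∑ i, g i) / ((N : ℝ) + 1) + ∑ i, ν i * g i ^ 2
        + 2 * ∑ j, coef a j * ((g j.castSucc + e j) *
            ∑ i : Fin (N + 1), if (j : ℕ) < i then g i else 0)
        + τ * ∑ j, e j ^ 2 := by
  have hgrad := sum_gradBlock ν a g
  have hge : ∑ i, ∑ j : Fin N, g i * ((if (j : ℕ) < (i : ℕ) then coef a j else 0) * e j)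
      = ∑ j, coef a j * (e j * ∑ i : Fin (N + 1), if (j : ℕ) < i then g i else 0) := by
    rw [sum_comm]
    refine sum_congr rfl fun j _ => ?_
    rw [mul_sum, mul_sum]
    refine sum_congr rfl fun k _ => ?_
    split_ifs
    · ring
    · ring
  have heg : ∑ j, ∑ i : Fin (N + 1), e j * ((if (j : ℕ) < (i : ℕ) then coef a j else 0) * g i)
      = ∑ j, coef a j * (e j * ∑ i : Fin (N + 1), if (j : ℕ) < i then g i else 0) := by
    rw [← hge, sum_comm]
    exact sum_congr rfl fun i _ => sum_congr rfl fun k _ => by ring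
  have hee : ∑ j, e j * (τ * e j) = τ * ∑ j, e j ^ 2 := by
    rw [mul_sum]
    exact sum_congr rfl fun i _ => by ring
  have hxg : ∑ i, x * (-1 / (2 * ((N : ℝ) + 1)) * g i) = - (x * (∑ i, g i) / ((N : ℝ) + 1)) / 2 := by
    rw [← mul_sum, ← mul_sum]
    field_simp
  have hgx : ∑ i, g i * (-1 / (2 * ((N : ℝ) + 1)) * x) = - (x * (∑ i, g i) / ((N : ℝ) + 1)) / 2 := by
    rw [← hxg]
    exact sum_congr rfl fun i _ => by ring
  have hsplit : ∑ j, coef a j * ((g j.castSucc + e j) *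
        ∑ i : Fin (N + 1), if (j : ℕ) < i then g i else 0)
      = ∑ j, coef a j * (g j.castSucc * ∑ i : Fin (N + 1), if (j : ℕ) < i then g i else 0)
        + ∑ j, coef a j * (e j * ∑ i : Fin (N + 1), if (j : ℕ) < i then g i else 0) := by
    rw [← sum_add_distrib]
    exact sum_congr rfl fun i _ => by ring
  have hexpand : (Sum.elim (Sum.elim (fun _ : Unit => x) g) e) ⬝ᵥ
        (Lam νstar ν τ a *ᵥ Sum.elim (Sum.elim (fun _ : Unit => x) g) e)
      = x * (νstar * x) + ∑ i, x * (-1 / (2 * ((N : ℝ) + 1)) * g i)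
        + ∑ i, g i * (-1 / (2 * ((N : ℝ) + 1)) * x)
        + ∑ i, ∑ k, g i * (gradBlock ν a i k * g k)
        + ∑ i, ∑ j : Fin N, g i * ((if (j : ℕ) < (i : ℕ) then coef a j else 0) * e j)
        + ∑ j, ∑ i : Fin (N + 1), e j * ((if (j : ℕ) < (i : ℕ) then coef a j else 0) * g i)
        + ∑ j, e j * (τ * e j) := by
    have hone : ∀ j, ∑ k, (τ • (1 : Matrix (Fin N) (Fin N) ℝ)) j k * e k = τ * e j := by
      intro j
      simp [Matrix.smul_apply, one_apply]
    simp only [dotProduct, mulVec, Fintype.sum_sum_type, Sum.elim_inl, Sum.elim_inr, Lam,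
      upperBlock, errBlock, fromBlocks_apply₁₁, fromBlocks_apply₁₂, fromBlocks_apply₂₁,
      fromBlocks_apply₂₂, fromRows_apply_inl, fromRows_apply_inr, of_apply, transpose_apply,
      Matrix.zero_apply, zero_mul, sum_const_zero, add_zero, zero_add, univ_unique, sum_singleton,
      hone]
    simp only [mul_add, sum_add_distrib, mul_sum]
    ring
  rw [hexpand, hxg, hgx, hgrad, hge, heg, hee, hsplit]
  ring

/-! ### The semidefinite bound is at most the second-order cone bound -/

theorem Lam_isHermitian {N : ℕ} (νstar : ℝ) (ν : Fin (N + 1) → ℝ) (τ : ℝ) (a : Fin N → ℝ) :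
    (Lam νstar ν τ a).IsHermitian := by
  have hg : (gradBlock ν a).IsHermitian := by
    ext i k
    rcases lt_trichotomy i k with h | h | h
    · simp [gradBlock, h, h.not_gt]
    · simp [gradBlock, h]
    · simp [gradBlock, h, h.not_gt]
  refine IsHermitian.fromBlocks (IsHermitian.fromBlocks ?_ ?_ hg) ?_ ?_
  · ext; simp
  · ext; simp
  · exact conjTranspose_eq_transpose_of_trivial _
  · ext i j
    by_cases h : i = j <;> simp [one_apply, h, eq_comm]

/-- In terms of the tail sums `T_j` of `g`, the form is a telescoping sum plus squares; what remains
is a binary form in `x` and `T_0`, which `h0` makes a perfect square. -/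
theorem Lam_posSemidef {N : ℕ} (y : ℕ → ℝ) (hy : ∀ k < N, y k + y k ^ 2 ≤ y (k + 1))
    (τ νstar : ℝ) (hτ : 0 ≤ τ) (hνs : 0 ≤ νstar)
    (h0 : 4 * ((N : ℝ) + 1) ^ 2 * (τ * y 0) * νstar = 1) (a : Fin N → ℝ)
    (ha : ∀ j : Fin N, coef a j = τ * y j) :
    (Lam νstar (fun k => τ * y k) τ a).PosSemidef := by
  refine PosSemidef.of_dotProduct_mulVec_nonneg (Lam_isHermitian _ _ _ _) fun v => ?_
  obtain ⟨x, g, e, rfl⟩ : ∃ x g e, v = Sum.elim (Sum.elim (fun _ : Unit => x) g) e :=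
    ⟨v (.inl (.inl ())), fun i => v (.inl (.inr i)), fun j => v (.inr j), by
      ext ((_ | _) | _) <;> rfl⟩
  rw [star_trivial, Lam_quadForm]
  set T : ℕ → ℝ := fun j => ∑ i : Fin (N + 1), if j ≤ (i : ℕ) then g i else 0 with hT
  have hT0 : T 0 = ∑ i, g i := by simp [hT]
  have hTsucc : ∀ i : Fin (N + 1), T i = g i + T (i + 1) := by
    intro i
    have hgi : g i = ∑ k : Fin (N + 1), if i = k then g k else 0 := by simp
    rw [hgi, hT, ← sum_add_distrib]
    refine sum_congr rfl fun k _ => ?_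
    rcases lt_trichotomy i k with h | h | h
    · simp [Fin.lt_def.1 h, h.ne, (Fin.lt_def.1 h).le]
    · simp [h]
    · have h' := Fin.lt_def.1 h
      simp [h.ne', show ¬ ((i : ℕ) ≤ k) by omega, show ¬ ((i : ℕ) + 1 ≤ k) by omega]
  have hTN : T N = g (Fin.last N) := by
    have h1 := hTsucc (Fin.last N)
    have h2 : T (N + 1) = 0 := sum_eq_zero fun i _ => if_neg (by omega)
    rw [Fin.val_last, h2] at h1
    linarith
  have hS : ∀ j : Fin N, (∑ i : Fin (N + 1), if (j : ℕ) < i then g i else 0) = T (j + 1) :=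
    fun j => rfl
  -- Right minus left is `τ (e_j + y_j T_{j+1})² + τ (y_{j+1} - y_j - y_j²) T_{j+1}²`.
  have hterm : ∀ j : Fin N, τ * (y j * T j ^ 2 - y (j + 1) * T (j + 1) ^ 2)
      ≤ τ * y j * g j.castSucc ^ 2 + 2 * (τ * y j * ((g j.castSucc + e j) * T (j + 1)))
        + τ * e j ^ 2 := by
    intro j
    have h1 := hTsucc j.castSucc
    rw [Fin.val_castSucc] at h1
    have h2 : g j.castSucc = T j - T (j + 1) := by linarith
    have h3 := mul_le_mul_of_nonneg_right (hy j j.2) (mul_nonneg hτ (sq_nonneg (T (j + 1))))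
    have h4 := mul_nonneg hτ (sq_nonneg (e j + y j * T (j + 1)))
    rw [h2]
    nlinarith
  have hsum := sum_le_sum fun j (_ : j ∈ univ) => hterm j
  have htel : ∑ j : Fin N, τ * (y j * T j ^ 2 - y (j + 1) * T (j + 1) ^ 2)
      = τ * (y 0 * T 0 ^ 2 - y N * T N ^ 2) := by
    rw [← mul_sum, Fin.sum_univ_eq_sum_range (fun j => y j * T j ^ 2 - y (j + 1) * T (j + 1) ^ 2),
      sum_range_sub' (fun j => y j * T j ^ 2)]
  rw [htel, sum_add_distrib, sum_add_distrib, ← mul_sum, ← mul_sum, hTN] at hsum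
  simp only [hS, ha]
  rw [Fin.sum_univ_castSucc (fun i : Fin (N + 1) => τ * y i * g i ^ 2), Fin.val_last, ← hT0]
  simp only [Fin.val_castSucc]
  have hx : 0 ≤ νstar * x ^ 2 - x * T 0 / ((N : ℝ) + 1) + τ * (y 0 * T 0 ^ 2) := by
    have hne : νstar ≠ 0 := by
      rintro rfl
      simp at h0
    have hpos : 0 < νstar := lt_of_le_of_ne hνs hne.symm
    have h1 : νstar * x ^ 2 - x * T 0 / ((N : ℝ) + 1) + τ * (y 0 * T 0 ^ 2)
        = νstar * (x - T 0 / (2 * νstar * ((N : ℝ) + 1))) ^ 2 := by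
      have hN : (0 : ℝ) < (N : ℝ) + 1 := by positivity
      have h2 : τ * y 0 = 1 / (4 * ((N : ℝ) + 1) ^ 2 * νstar) := by
        rw [eq_div_iff (by positivity)]
        linarith
      rw [← mul_assoc, h2]
      field_simp
      ring
    rw [h1]
    positivity
  linarith

theorem valuesS_nonneg {N : ℕ} {R L σ v : ℝ} (hv : v ∈ valuesS N R L σ) : 0 ≤ v := by
  obtain ⟨α, τ, νs, ν, -, hτ, hνs, hν, -, rfl⟩ := hv
  have := sum_nonneg fun k (_ : k ∈ univ) => hν k
  positivity

theorem exists_mem_valuesS_of_mem_valuesL {N : ℕ} {R L σ v : ℝ} (hR : 0 < R) (hL : 0 < L)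
    (hv : v ∈ valuesL N σ) : ∃ w ∈ valuesS N R L σ, √((N : ℝ) + 1) * w = √v := by
  obtain ⟨y, hy0, hy, rfl⟩ := hv
  have hpos := pos_of_add_sq_le hy0 hy
  set A := σ ^ 2 + ∑ k ∈ range (N + 1), y k with hA
  have hApos : 0 < A := by
    have := sum_pos (fun k (hk : k ∈ range (N + 1)) => hpos k (Nat.lt_succ_iff.1 (mem_range.1 hk)))
      ⟨0, by simp⟩
    positivity
  set n := (N : ℝ) + 1 with hn
  have hnpos : 0 < n := by positivity
  set q := √(A * y 0) with hq
  have hqpos : 0 < q := Real.sqrt_pos.2 (by positivity)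
  have hqsq : q ^ 2 = A * y 0 := Real.sq_sqrt (by positivity)
  -- The constraint fixes the product of `τ` and `νs`; the sum `τ A + νs` is least when the two
  -- terms agree, whence `νs = A τ` and the value `2 A τ`.
  set τ := 1 / (2 * n * q) with hτ
  have hτpos : 0 < τ := by positivity
  set νs := A * τ with hνs
  have hνspos : 0 < νs := by positivity
  refine ⟨τ * σ ^ 2 + νs + ∑ k : Fin (N + 1), τ * y k, ⟨fun j => 2 * (N - (j : ℕ)) * (τ * y j) * R / L,
    τ, νs, fun k => τ * y k, fun k => ?_, hτpos.le, hνspos.le, fun k => ?_, ?_, rfl⟩, ?_⟩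
  · have h1 : ((k : ℕ) : ℝ) ≤ N := by exact_mod_cast k.2.le
    have h2 := hpos k k.2.le
    have h3 : (0 : ℝ) ≤ N - (k : ℕ) := by linarith
    positivity
  · have h2 := hpos k (Nat.lt_succ_iff.1 k.2)
    positivity
  · refine Lam_posSemidef y hy τ νs hτpos.le hνspos.le ?_ _ fun j => ?_
    · rw [← hn, hνs, hτ]
      field_simp
      rw [hqsq]
      ring
    · have h1 : ((j : ℕ) : ℝ) < N := by exact_mod_cast j.2
      have h3 : (N : ℝ) - (j : ℕ) ≠ 0 := by linarith
      rw [coef]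
      field_simp
  · have h1 : τ * σ ^ 2 + νs + ∑ k : Fin (N + 1), τ * y k = 2 * A * τ := by
      rw [← mul_sum, Fin.sum_univ_eq_sum_range y, hνs, hA]
      ring
    rw [h1]
    symm
    rw [Real.sqrt_eq_iff_mul_self_eq (by positivity) (by positivity), eq_comm]
    have h2 : √n * √n = n := Real.mul_self_sqrt hnpos.le
    calc √n * (2 * A * τ) * (√n * (2 * A * τ)) = (√n * √n) * (4 * A ^ 2 * τ ^ 2) := by ring
      _ = A / (n * y 0) := by
        rw [h2, hτ, div_pow, mul_pow, hqsq]
        field_simp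
        ring

theorem valuesL_nonempty (N : ℕ) (σ : ℝ) : (valuesL N σ).Nonempty := by
  let y : ℕ → ℝ := fun n => Nat.rec 1 (fun _ t => t + t ^ 2) n
  exact ⟨_, y, one_pos, fun k _ => le_rfl, rfl⟩

theorem uS_le_uL {N : ℕ} {R L σ : ℝ} (hR : 0 < R) (hL : 0 < L) : uS N R L σ ≤ uL N σ := by
  have hbdd : BddBelow (valuesS N R L σ) := ⟨0, fun v hv => valuesS_nonneg hv⟩
  have h0 : 0 ≤ sInf (valuesS N R L σ) := Real.sInf_nonneg fun v hv => valuesS_nonneg hv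
  rw [uL, uS]
  refine Real.le_sqrt_of_sq_le (le_csInf (valuesL_nonempty N σ) fun v hv => ?_)
  obtain ⟨w, hw, hwv⟩ := exists_mem_valuesS_of_mem_valuesL hR hL hv
  have h1 := mul_le_mul_of_nonneg_left (csInf_le hbdd hw) (Real.sqrt_nonneg ((N : ℝ) + 1))
  rw [hwv] at h1
  calc _ ≤ √v ^ 2 := by gcongr
    _ = v := Real.sq_sqrt (valuesL_nonneg hv)

/-! ### `ℓ_N` is at most the semidefinite bound -/

/-- Summing the form over coordinates tests `Λ` against the Gram matrix of vectors `X`, `G_i`,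
`E_j`. -/
theorem Lam_gram_nonneg {N : ℕ} {ι : Type*} [Fintype ι] {νstar : ℝ} {ν : Fin (N + 1) → ℝ} {τ : ℝ}
    {a : Fin N → ℝ} (h : (Lam νstar ν τ a).PosSemidef) (X : ι → ℝ) (G : Fin (N + 1) → ι → ℝ)
    (E : Fin N → ι → ℝ) :
    0 ≤ νstar * (∑ d, X d ^ 2) - (∑ d, X d * ∑ i, G i d) / ((N : ℝ) + 1)
        + ∑ i, ν i * ∑ d, G i d ^ 2
        + 2 * ∑ j, coef a j * ∑ d, ((G j.castSucc d + E j d) *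
            ∑ i : Fin (N + 1), if (j : ℕ) < i then G i d else 0)
        + τ * ∑ j, ∑ d, E j d ^ 2 := by
  have hd := sum_nonneg fun d (_ : d ∈ univ) =>
    h.dotProduct_mulVec_nonneg (Sum.elim (Sum.elim (fun _ : Unit => X d) fun i => G i d)
      fun j => E j d)
  simp only [star_trivial, Lam_quadForm, sum_add_distrib, sum_sub_distrib, ← mul_sum,
    ← sum_div] at hd
  rw [sum_comm (f := fun d i => ν i * G i d ^ 2), sum_comm (f := fun d j => E j d ^ 2),
    sum_comm (f := fun d j => coef a j * _)] at hd
  simpa only [← mul_sum] using hd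

theorem sum_ite_lt_const {N : ℕ} (j : Fin N) (t : ℝ) :
    (∑ i : Fin (N + 1), if (j : ℕ) < i then t else 0) = ((N : ℝ) - (j : ℕ)) * t := by
  rw [Fin.sum_univ_eq_sum_range (fun i => if (j : ℕ) < i then t else 0), ← sum_filter]
  have h : (range (N + 1)).filter (fun i => (j : ℕ) < i) = Ico ((j : ℕ) + 1) (N + 1) := by
    ext i
    simp only [mem_filter, mem_range, mem_Ico]
    omega
  rw [h, sum_const, Nat.card_Ico, nsmul_eq_mul, Nat.cast_sub (by omega)]
  push_cast
  ring

theorem ell_le_uS {N : ℕ} {R L σ : ℝ} (hN : 1 ≤ N) (hR : 0 < R) (hL : 0 < L)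
    (hσ : σ ∈ Set.Icc 0 √(N : ℝ)) : ell N σ ≤ uS N R L σ := by
  have hne : (valuesS N R L σ).Nonempty := by
    obtain ⟨v, hv⟩ := valuesL_nonempty N σ
    obtain ⟨w, hw, -⟩ := exists_mem_valuesS_of_mem_valuesL hR hL hv
    exact ⟨w, hw⟩
  have hn : (0 : ℝ) < (N : ℝ) + 1 := by positivity
  have hsn : 0 < √((N : ℝ) + 1) := Real.sqrt_pos.2 hn
  have hsn2 : √((N : ℝ) + 1) ^ 2 = (N : ℝ) + 1 := Real.sq_sqrt hn.le
  rw [uS, ← div_le_iff₀' hsn]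
  refine le_csInf hne ?_
  rintro v ⟨α, τ, νs, ν, -, -, -, -, hpsd, rfl⟩
  obtain ⟨⟨hν0, hν1⟩, hsum⟩ := nu_mem N hN σ hσ
  have hl1 := one_le_ell N hN σ hσ
  have hl2 : ell N σ ^ 2 = 1 + N * nu N σ := Real.sq_sqrt (by positivity)
  set l := ell N σ
  set p := nu N σ
  set s := √p with hs
  set t := √(1 - p) with ht
  have hs2 : s ^ 2 = p := Real.sq_sqrt hν0
  have ht2 : t ^ 2 = 1 - p := Real.sq_sqrt (by linarith)
  set r := √((N : ℝ) + 1) with hr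
  -- Unit vectors with all pairwise inner products equal to `p`: a shared coordinate `s = √p` and a
  -- private one `t = √(1 - p)`. `S j` is the sum of `G i` over `i > j`.
  let G : Fin (N + 1) → Option (Fin (N + 1)) → ℝ :=
    fun i d => d.elim s fun m => if i = m then t else 0
  let S : Fin N → Option (Fin (N + 1)) → ℝ :=
    fun j d => d.elim (((N : ℝ) - (j : ℕ)) * s) fun m => if (j : ℕ) < m then t else 0
  -- Projection coefficient of `G_j` on `S_j`: the error `-c_j S_j` makes `G_j + E_j` orthogonal to
  -- `S_j`, so all `a_j` terms vanish. The equation defining `ν` says that the squared errors sum to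
  -- `σ²`.
  let c : Fin N → ℝ := fun j => p / (1 + ((N : ℝ) - ((j : ℕ) + 1)) * p)
  -- The normalized sum of the `G_i`, whose norm is `√(N + 1) · ℓ`.
  let X : Option (Fin (N + 1)) → ℝ :=
    fun d => d.elim (((N : ℝ) + 1) * s / (r * l)) fun _ => t / (r * l)
  have hpos : ∀ j : Fin N, 0 < 1 + ((N : ℝ) - ((j : ℕ) + 1)) * p := by
    intro j
    have h1 : ((j : ℕ) : ℝ) + 1 ≤ N := by exact_mod_cast j.2
    have h2 := mul_nonneg (sub_nonneg.2 h1) hν0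
    linarith
  have hS : ∀ (j : Fin N) d, (∑ i : Fin (N + 1), if (j : ℕ) < i then G i d else 0) = S j d := by
    rintro j (_ | m)
    · exact sum_ite_lt_const j s
    · simp only [G, S, Option.elim]
      rw [sum_eq_single m (fun i _ hi => by simp [hi]) (by simp)]
      simp
  have hSS : ∀ j, ∑ d, S j d ^ 2
      = ((N : ℝ) - (j : ℕ)) * (1 + ((N : ℝ) - ((j : ℕ) + 1)) * p) := by
    intro j
    simp only [S, Fintype.sum_option, Option.elim, ite_pow, ne_eq, OfNat.ofNat_ne_zero,
      not_false_eq_true, zero_pow]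
    rw [sum_ite_lt_const, mul_pow, hs2, ht2]
    ring
  have hGS : ∀ j : Fin N, ∑ d, G j.castSucc d * S j d = ((N : ℝ) - (j : ℕ)) * p := by
    intro j
    simp only [S, G, Fintype.sum_option, Option.elim]
    rw [sum_eq_zero fun m _ => ?_, ← hs2]
    · ring
    · by_cases h : j.castSucc = m
      · simp [← h]
      · simp [h]
  have hGG : ∀ i, ∑ d, G i d ^ 2 = 1 := by
    intro i
    simp [G, Fintype.sum_option, hs2, ht2]
  have hsumG : ∀ d, ∑ i, G i d = (r * l) * X d := by
    have hrl : r * l ≠ 0 := by positivity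
    rintro (_ | m)
    · simp only [G, X, Option.elim, sum_const, card_univ, Fintype.card_fin, nsmul_eq_mul]
      rw [mul_div_cancel₀ _ hrl]
      push_cast
      ring
    · simp only [G, X, Option.elim, sum_ite_eq', mem_univ, if_true]
      rw [mul_div_cancel₀ _ hrl]
  have hXX : ∑ d, X d ^ 2 = 1 := by
    simp only [X, Fintype.sum_option, Option.elim, sum_const, card_univ, Fintype.card_fin,
      nsmul_eq_mul, div_pow, mul_pow, hs2, ht2, hl2, hsn2]
    have : (0 : ℝ) < 1 + N * p := by positivity
    push_cast
    field_simp
    ring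
  have hXG : ∑ d, X d * ∑ i, G i d = r * l := by
    simp only [hsumG]
    calc ∑ d, X d * (r * l * X d) = r * l * ∑ d, X d ^ 2 := by
          rw [mul_sum]
          exact sum_congr rfl fun d _ => by ring
      _ = r * l := by rw [hXX, mul_one]
  have hGE : ∀ j : Fin N, ∑ d, (G j.castSucc d + -c j * S j d) * S j d = 0 := by
    intro j
    have h1 : ∑ d, (G j.castSucc d + -c j * S j d) * S j d
        = ∑ d, G j.castSucc d * S j d - c j * ∑ d, S j d ^ 2 := by
      rw [mul_sum, ← sum_sub_distrib]
      exact sum_congr rfl fun d _ => by ring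
    rw [h1, hGS, hSS]
    have hc : c j * (1 + ((N : ℝ) - ((j : ℕ) + 1)) * p) = p := div_mul_cancel₀ _ (hpos j).ne'
    linear_combination -((N : ℝ) - (j : ℕ)) * hc
  have hEE : ∑ j, ∑ d, (-c j * S j d) ^ 2 = σ ^ 2 := by
    rw [← hsum, ← Fin.sum_univ_eq_sum_range
      (fun k => (((N : ℝ) - k) * p ^ 2) / (1 + ((N : ℝ) - (k + 1)) * p))]
    refine sum_congr rfl fun j _ => ?_
    simp only [mul_pow, ← mul_sum, hSS]
    have := (hpos j).ne'
    simp only [c]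
    field_simp
  have key := Lam_gram_nonneg hpsd X G fun j d => -c j * S j d
  simp only [hS, hXX, hXG, hGG, hGE, hEE, mul_zero, sum_const_zero, mul_one, add_zero] at key
  have hrl : r * l / ((N : ℝ) + 1) = l / r := by
    rw [← hsn2]
    field_simp
  rw [hrl] at key
  linarith

end SubgradSqueeze

/-! ### Assembling the chain and the uniform gap -/

theorem mainTheorem1 :
    (∀ (N : ℕ) (R L γ : ℝ), 1 ≤ N → 0 < R → 0 < L → γ / L ∈ Set.Icc 0 √(N : ℝ) →
      (1 - 5 / 2 * (Real.log ((N : ℝ) + 1) / N)) * SubgradSqueeze.u (γ / L)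
          ≤ SubgradSqueeze.ell N (γ / L) ∧
        SubgradSqueeze.ell N (γ / L) ≤ SubgradSqueeze.uS N R L (γ / L) ∧
        SubgradSqueeze.uS N R L (γ / L) ≤ SubgradSqueeze.uL N (γ / L) ∧
        SubgradSqueeze.uL N (γ / L) ≤ SubgradSqueeze.u (γ / L)) ∧
    (∃ C : ℝ, 0 < C ∧ ∀ (N : ℕ) (R L γ : ℝ), 2 ≤ N → 0 < R → 0 < L →
      γ / L ∈ Set.Icc 0 √(N : ℝ) →
      (SubgradSqueeze.uS N R L (γ / L) - SubgradSqueeze.ell N (γ / L))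
            / SubgradSqueeze.ell N (γ / L) ≤ C * (Real.log N / N) ∧
        (SubgradSqueeze.uL N (γ / L) - SubgradSqueeze.ell N (γ / L))
            / SubgradSqueeze.ell N (γ / L) ≤ C * (Real.log N / N) ∧
        (SubgradSqueeze.u (γ / L) - SubgradSqueeze.ell N (γ / L))
            / SubgradSqueeze.ell N (γ / L) ≤ C * (Real.log N / N)) := by
  have hgap : ∀ (N : ℕ) (σ : ℝ), 2 ≤ N → σ ∈ Set.Icc 0 √(N : ℝ) → ∀ v ≤ SubgradSqueeze.u σ,
      (v - SubgradSqueeze.ell N σ) / SubgradSqueeze.ell N σ ≤ 1 * (Real.log N / N) := by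
    intro N σ hN hσ v hv
    have hl := SubgradSqueeze.one_le_ell N (by omega) σ hσ
    have hu := SubgradSqueeze.u_le_mul_ell N (by omega) σ hσ
    have hN' : (2 : ℝ) ≤ N := by exact_mod_cast hN
    -- Here `N ≥ 2` gives `N + 1 ≤ N²`, so `C = 1` suffices.
    have hlog : Real.log ((N : ℝ) + 1) ≤ 2 * Real.log N := by
      have h := Real.log_le_log (by positivity) (show (N : ℝ) + 1 ≤ (N : ℝ) ^ 2 by nlinarith)
      rwa [Real.log_pow, Nat.cast_ofNat] at h
    have hlog' : Real.log ((N : ℝ) + 1) / N / 2 ≤ Real.log N / N := by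
      rw [div_right_comm]
      gcongr
      linarith
    rw [div_le_iff₀ (by linarith)]
    nlinarith
  refine ⟨fun N R L γ hN hR hL hσ => ⟨?_, SubgradSqueeze.ell_le_uS hN hR hL hσ,
    SubgradSqueeze.uS_le_uL hR hL, SubgradSqueeze.uL_le_u N _⟩, 1, one_pos,
    fun N R L γ hN hR hL hσ => ?_⟩
  · have hl := SubgradSqueeze.one_le_ell N hN _ hσ
    have hu := SubgradSqueeze.u_le_mul_ell N hN _ hσ
    have hu1 := (SubgradSqueeze.u_mem (γ / L)).1
    have hε : 0 ≤ Real.log ((N : ℝ) + 1) / N :=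
      div_nonneg (Real.log_nonneg (by linarith [Nat.cast_nonneg (α := ℝ) N])) (Nat.cast_nonneg N)
    set ε := Real.log ((N : ℝ) + 1) / N
    -- When the prefactor is nonpositive the bound is trivial; otherwise it multiplies `u ≤ (1 + ε /
    -- 2) ℓ`. The constant `5 / 2` leaves room, since `1 / 2` would do.
    rcases le_total (1 - 5 / 2 * ε) 0 with h | h
    · nlinarith
    · have h1 := mul_le_mul_of_nonneg_left hu h
      have h2 : (1 - 5 / 2 * ε) * (1 + ε / 2) ≤ 1 := by nlinarith
      nlinarith
  · have h2 := SubgradSqueeze.uL_le_u N (γ / L)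
    have h1 := (SubgradSqueeze.uS_le_uL (N := N) (σ := γ / L) hR hL).trans h2
    exact ⟨hgap N _ hN hσ _ h1, hgap N _ hN hσ _ h2, hgap N _ hN hσ _ le_rfl⟩
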